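/- Let $\mathsf{N_C},\mathsf{N_R},\mathsf{N_I}$ be finite, non-empty, mutually disjoint sets of concept, role and individual names. A role is $R$ or $R^-$ with $R\in\mathsf{N_R}$; a basic concept is a concept name $A$ or $\exists S$ with $S$ a role. A DL-Lite$^{\mathcal H}$ axiom is a role inclusion $S\sqsubseteq S'$ between roles, a concept inclusion $B\sqsubseteq C$ with $B$ basic and $C$ either basic or the negation $\neg B'$ of a basic concept, a concept assertion $D(a)$ with $D$ basic, or a role assertion $R(a,b)$ with $R\in\mathsf{N_R}$. A knowledge base (KB) $\mathcal K$ is a TBox (a set of inclusions) together with an ABox (a set of assertions). Satisfiability of $\mathcal K$ and entailment $\mathcal K\models\alpha$ refer to the usual first-order semantics over non-empty domains; $\alpha$ is consistent with $\mathcal K$ if some interpretation satisfies $\mathcal K\cup\{\alpha\}$. Fix $\epsilon,s>0$ and $d\ge 1$. All inequalities between vectors of $\mathbb R^d$ are elementwise, and scalars also denote constant vectors. A box is a set $\{x\in\mathbb R^d: L+\epsilon\le x\le U-\epsilon\}$ with $0\le U-L\le 2s$. A non-empty set of the form $\{x: L+\epsilon\le x\le U-\epsilon\}$ has lower bound $L$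 and upper bound $U$; the empty set has both bounds $0$. A box interpretation $\eta$ in $\mathbb R^d$ assigns to each $a\in\mathsf{N_I}$ vectors $\mathrm{pos}(a),\mathrm{bump}(a)\in[-s,s]^d$, to each $A\in\mathsf{N_C}$ a box $\eta(A)$, and to each $R\in\mathsf{N_R}$ boxes $H_R$ (head), $T_R$ (tail), $B_R$ (bump box). Put $H_{R^-}=T_R$, $T_{R^-}=H_R$, $B_{R^-}=B_R$, and, writing $L_X,U_X$ for the bounds of $X$, put $\eta(\exists S)=\{x: L_{H_S}-U_{B_S}+\epsilon\le x\le U_{H_S}-L_{B_S}-\epsilon\}$ and $\eta(\neg B)=\{x: -s-L_{\eta(B)}+\epsilon\le x\le s-U_{\eta(B)}-\epsilon\}$. Satisfaction $\eta\models\alpha$ means: for $S\sqsubseteq S'$, that $H_S\subseteq H_{S'}$, $T_S\subseteq T_{S'}$ and $B_S\subseteq B_{S'}$; for $B\sqsubseteq C$, that $\eta(B)\subseteq\eta(C)$; for $D(a)$, that $\mathrm{pos}(a)\in\eta(D)$; for $R(a,b)$, that $\mathrm{pos}(a)+\mathrm{bump}(b)\in H_R$, $\mathrm{pos}(b)+\mathrm{bump}(a)\in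 T_R$ and $\mathrm{bump}(a),\mathrm{bump}(b)\in B_R$. The interpretation $\eta$ is box consistent if $\eta(B)\cap\eta(\neg B)=\emptyset$ for every basic concept $B$. It is a KB faithful model of $\mathcal K$ if it satisfies every axiom entailed by $\mathcal K$ and every axiom it satisfies is consistent with $\mathcal K$. Theorem. There is a universe size $s$, namely $s=4$, such that for every $\epsilon$ with $0<\epsilon\le 1/2$, every satisfiable DL-Lite$^{\mathcal H}$ KB $\mathcal K$ has, in some dimension $d\ge 1$, a box interpretation $\eta$ that is box consistent and a KB faithful model of $\mathcal K$. Moreover, $\eta$ can be chosen so that in addition $\mathcal K\models\alpha$ if and only if $\eta\models\alpha$, for every concept inclusion and every concept assertion $\alpha$. -/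

import Mathlib

universe u

namespace BoxLitE

/-! # Syntax of the description logic over concept, role and individual names -/

/-- Roles: a role name `R` or its inverse. -/
inductive Role (NR : Type u) : Type u
  | name (R : NR) : Role NR
  | inv (R : NR) : Role NR

/-- The set of basic concepts `A` and `∃ S`, with `A` a concept name and `S` a role. -/
inductive BasicConcept (NC NR : Type u) : Type u
  | atom (A : NC) : BasicConcept NC NR
  | ex (S : Role NR) : BasicConcept NC NR

/-- Right-hand sides of concept inclusions: basic concepts and their negations. -/
inductive Concept (NC NR : Type u) : Type u
  | basic (B : BasicConcept NC NR) : Concept NC NR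
  | neg (B : BasicConcept NC NR) : Concept NC NR

/-- Role inclusions `S ⊑ T` and concept inclusions `B ⊑ C`. -/
inductive Inclusion (NC NR : Type u) : Type u
  | role (S T : Role NR) : Inclusion NC NR
  | concept (B : BasicConcept NC NR) (C : Concept NC NR) : Inclusion NC NR

/-- Concept assertions `D(a)` and role assertions `R(a, b)`. -/
inductive Assertion (NC NR NI : Type u) : Type u
  | concept (D : BasicConcept NC NR) (a : NI) : Assertion NC NR NI
  | role (R : NR) (a b : NI) : Assertion NC NR NI

/-- An axiom is a role inclusion, a concept inclusion or an assertion. -/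
inductive KBAxiom (NC NR NI : Type u) : Type u
  | incl (α : Inclusion NC NR) : KBAxiom NC NR NI
  | assertion (α : Assertion NC NR NI) : KBAxiom NC NR NI

/-- A knowledge base: a TBox and an ABox. (Over finite sets of names there are only finitely many
axioms, so these sets are automatically finite.) -/
structure KB (NC NR NI : Type u) where
  tbox : Set (Inclusion NC NR)
  abox : Set (Assertion NC NR NI)

/-- The set of all axioms of a knowledge base. -/
def KB.axioms {NC NR NI : Type u} (K : KB NC NR NI) : Set (KBAxiom NC NR NI) :=
  KBAxiom.incl '' K.tbox ∪ KBAxiom.assertion '' K.abox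

/-! # Classical semantics -/

/-- A classical interpretation, with non-empty domain and no unique name assumption. -/
structure Interpretation (NC NR NI : Type u) where
  Dom : Type u
  nonempty : Nonempty Dom
  concept : NC → Set Dom
  role : NR → Set (Dom × Dom)
  ind : NI → Dom

namespace Interpretation

variable {NC NR NI : Type u} (I : Interpretation NC NR NI)

def roleExt : Role NR → Set (I.Dom × I.Dom)
  | .name R => I.role R
  | .inv R => {p | (p.2, p.1) ∈ I.role R}

def basicExt : BasicConcept NC NR → Set I.Dom
  | .atom A => I.concept A
  | .ex S => {d | ∃ e, (d, e) ∈ I.roleExt S}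

def conceptExt : Concept NC NR → Set I.Dom
  | .basic B => I.basicExt B
  | .neg B => (I.basicExt B)ᶜ

/-- `I ⊨ α`. -/
def Sat : KBAxiom NC NR NI → Prop
  | .incl (.role S T) => I.roleExt S ⊆ I.roleExt T
  | .incl (.concept B C) => I.basicExt B ⊆ I.conceptExt C
  | .assertion (.concept D a) => I.ind a ∈ I.basicExt D
  | .assertion (.role R a b) => (I.ind a, I.ind b) ∈ I.role R

/-- `I ⊨ K`. -/
def Models (K : KB NC NR NI) : Prop := ∀ α ∈ K.axioms, I.Sat α

end Interpretation

namespace KB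

variable {NC NR NI : Type u} (K : KB NC NR NI)

def Satisfiable : Prop := ∃ I : Interpretation NC NR NI, I.Models K

/-- `K ⊨ α`. -/
def Entails (α : KBAxiom NC NR NI) : Prop :=
  ∀ I : Interpretation NC NR NI, I.Models K → I.Sat α

/-- `α` is consistent with `K`: some interpretation satisfies `K ∪ {α}`. -/
def ConsistentWith (α : KBAxiom NC NR NI) : Prop :=
  ∃ I : Interpretation NC NR NI, I.Models K ∧ I.Sat α

end KB

/-! # Boxes -/

/-- The set `{x ∈ ℝ^d | L + ε ≤ x ≤ U - ε}`, with elementwise comparison. -/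
def boxSet {d : ℕ} (ε : ℝ) (L U : Fin d → ℝ) : Set (Fin d → ℝ) :=
  {x | ∀ i, L i + ε ≤ x i ∧ x i ≤ U i - ε}

/-- The universe box `{x ∈ ℝ^d | -s ≤ x ≤ s}`. -/
def universeBox (d : ℕ) (s : ℝ) : Set (Fin d → ℝ) :=
  {x | ∀ i, -s ≤ x i ∧ x i ≤ s}

/-- Membership in the set of boxes. -/
def IsBox {d : ℕ} (ε s : ℝ) (X : Set (Fin d → ℝ)) : Prop :=
  ∃ L U : Fin d → ℝ, (∀ i, 0 ≤ U i - L i ∧ U i - L i ≤ 2 * s) ∧ X = boxSet ε L U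

open Classical in
/-- The lower bound of a box: for a non-empty box `{x | L + ε ≤ x ≤ U - ε}` it is `L`
(see `lower_boxSet`), and for the empty box it is `0`. -/
noncomputable def lower {d : ℕ} (ε : ℝ) (X : Set (Fin d → ℝ)) : Fin d → ℝ :=
  if X.Nonempty then fun i => sInf ((fun x => x i) '' X) - ε else 0

open Classical in
/-- The upper bound of a box: for a non-empty box `{x | L + ε ≤ x ≤ U - ε}` it is `U`
(see `upper_boxSet`), and for the empty box it is `0`. -/
noncomputable def upper {d : ℕ} (ε : ℝ) (X : Set (Fin d → ℝ)) : Fin d → ℝ :=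
  if X.Nonempty then fun i => sSup ((fun x => x i) '' X) + ε else 0

theorem lower_boxSet {d : ℕ} {ε : ℝ} {L U : Fin d → ℝ} (h : (boxSet ε L U).Nonempty) :
    lower ε (boxSet ε L U) = L := by
  have hle : ∀ i, L i + ε ≤ U i - ε := fun i => by
    obtain ⟨x, hx⟩ := h
    exact (hx i).1.trans (hx i).2
  funext i
  have hl : IsLeast ((fun x : Fin d → ℝ => x i) '' boxSet ε L U) (L i + ε) :=
    ⟨⟨fun j => L j + ε, fun j => ⟨le_rfl, hle j⟩, rfl⟩, by rintro _ ⟨x, hx, rfl⟩; exact (hx i).1⟩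
  simp [lower, if_pos h, hl.csInf_eq]

theorem upper_boxSet {d : ℕ} {ε : ℝ} {L U : Fin d → ℝ} (h : (boxSet ε L U).Nonempty) :
    upper ε (boxSet ε L U) = U := by
  have hle : ∀ i, L i + ε ≤ U i - ε := fun i => by
    obtain ⟨x, hx⟩ := h
    exact (hx i).1.trans (hx i).2
  funext i
  have hl : IsGreatest ((fun x : Fin d → ℝ => x i) '' boxSet ε L U) (U i - ε) :=
    ⟨⟨fun j => U j - ε, fun j => ⟨hle j, le_rfl⟩, rfl⟩, by rintro _ ⟨x, hx, rfl⟩; exact (hx i).2⟩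
  simp [upper, if_pos h, hl.csSup_eq]

/-- The complement box `{x | -s - L + ε ≤ x ≤ s - U - ε}` of a box with bounds `L`, `U`. -/
noncomputable def complBox {d : ℕ} (ε s : ℝ) (X : Set (Fin d → ℝ)) : Set (Fin d → ℝ) :=
  boxSet ε (fun i => -s - lower ε X i) (fun i => s - upper ε X i)

/-! # Box interpretations -/

/-- A box interpretation in `ℝ^d` with margin `ε` and universe size `s`. -/
structure BoxInterpretation (ε s : ℝ) (d : ℕ) (NC NR NI : Type u) where
  pos : NI → Fin d → ℝ
  bump : NI → Fin d → ℝ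
  concept : NC → Set (Fin d → ℝ)
  head : NR → Set (Fin d → ℝ)
  tail : NR → Set (Fin d → ℝ)
  bumpBox : NR → Set (Fin d → ℝ)
  pos_mem : ∀ a, pos a ∈ universeBox d s
  bump_mem : ∀ a, bump a ∈ universeBox d s
  concept_isBox : ∀ A, IsBox ε s (concept A)
  head_isBox : ∀ R, IsBox ε s (head R)
  tail_isBox : ∀ R, IsBox ε s (tail R)
  bumpBox_isBox : ∀ R, IsBox ε s (bumpBox R)

namespace BoxInterpretation

variable {ε s : ℝ} {d : ℕ} {NC NR NI : Type u} (η : BoxInterpretation ε s d NC NR NI)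

/-- Head box of a role; the inverse swaps head and tail. -/
def roleHead : Role NR → Set (Fin d → ℝ)
  | .name R => η.head R
  | .inv R => η.tail R

/-- Tail box of a role. -/
def roleTail : Role NR → Set (Fin d → ℝ)
  | .name R => η.tail R
  | .inv R => η.head R

/-- Bump box of a role. -/
def roleBump : Role NR → Set (Fin d → ℝ)
  | .name R => η.bumpBox R
  | .inv R => η.bumpBox R

/-- `η(B)` for a basic concept `B`; `η(∃ S)` is
`{x | L^H - U^B + ε ≤ x ≤ U^H - L^B - ε}` with `H`, `B` the head and bump boxes of `S`. -/
noncomputable def basicBox : BasicConcept NC NR → Set (Fin d → ℝ)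
  | .atom A => η.concept A
  | .ex S => boxSet ε (fun i => lower ε (η.roleHead S) i - upper ε (η.roleBump S) i)
      (fun i => upper ε (η.roleHead S) i - lower ε (η.roleBump S) i)

/-- `η(C)` for a basic concept or a negated basic concept. -/
noncomputable def conceptBox : Concept NC NR → Set (Fin d → ℝ)
  | .basic B => η.basicBox B
  | .neg B => complBox ε s (η.basicBox B)

/-- `η ⊨ α`. -/
def Sat : KBAxiom NC NR NI → Prop
  | .incl (.role S T) => η.roleBump S ⊆ η.roleBump T ∧ η.roleHead S ⊆ η.roleHead T ∧
      η.roleTail S ⊆ η.roleTail T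
  | .incl (.concept B C) => η.basicBox B ⊆ η.conceptBox C
  | .assertion (.concept D a) => η.pos a ∈ η.basicBox D
  | .assertion (.role R a b) => η.pos a + η.bump b ∈ η.head R ∧ η.pos b + η.bump a ∈ η.tail R ∧
      η.bump a ∈ η.bumpBox R ∧ η.bump b ∈ η.bumpBox R

/-- No basic concept has a box that meets its complement box. -/
def BoxConsistent : Prop :=
  ∀ B : BasicConcept NC NR, η.basicBox B ∩ complBox ε s (η.basicBox B) = ∅

/-- Every axiom satisfied by `η` is consistent with `K`. -/
def WeaklyFaithful (K : KB NC NR NI) : Prop :=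
  ∀ α : KBAxiom NC NR NI, η.Sat α → K.ConsistentWith α

/-- `η` satisfies every axiom entailed by `K`. -/
def KBEntailed (K : KB NC NR NI) : Prop :=
  ∀ α : KBAxiom NC NR NI, K.Entails α → η.Sat α

/-- `η` is a KB faithful model of `K`. -/
def KBFaithfulModel (K : KB NC NR NI) : Prop :=
  η.WeaklyFaithful K ∧ η.KBEntailed K

end BoxInterpretation

end BoxLitE

namespace BoxLitE

/-! # Finiteness of the syntax -/

/-! The axioms cannot force a role to be smaller than the product of its domain and range: enlarging
every role of a model to that product keeps all basic concepts and all satisfied axioms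
(`Sat.saturate`). So `S ⊑ T` is consistent with `K` once `K` entails `∃S ⊑ ∃T` and the same for the
inverses, and `R(a, b)` is consistent once `∃R(a)` and `∃R⁻(b)` are entailed. On the geometric side
all bumps can therefore be zero, and a satisfiable role is just a pair of boxes.

It remains to draw satisfiable basic concepts as products of intervals so that containment,
containment in a complement and membership mirror entailment. Each coordinate tests one concept `C`.
In the first kind, concepts below `C` get `[-1/2, 1/2]`, the others `[-3/2, 3/2]`, and non-instances
of `C` sit at `1`; this refutes non-entailed subsumptions and memberships. The second kind handles
negation: `B ⊆ ¬D` forces the right end points to sum to at most `4 - 2ε`. Disjoint pairs sum to at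
most `3` everywhere (`right_add_right_le`), while in the coordinate of `C` the concept `C` and any
concept not disjoint from it sum to at least `7/2 + 3/2 = 5`. -/

theorem finite_role {NR : Type u} [Finite NR] : Finite (Role NR) :=
  Finite.of_surjective (fun x : NR ⊕ NR => Sum.elim Role.name Role.inv x) (by
    rintro (R | R)
    exacts [⟨.inl R, rfl⟩, ⟨.inr R, rfl⟩])

theorem finite_basicConcept {NC NR : Type u} [Finite NC] [Finite NR] :
    Finite (BasicConcept NC NR) :=
  have := finite_role (NR := NR)
  Finite.of_surjective
    (fun x : NC ⊕ Role NR => Sum.elim BasicConcept.atom BasicConcept.ex x) (by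
    rintro (A | S)
    exacts [⟨.inl A, rfl⟩, ⟨.inr S, rfl⟩])

/-- The inverse of a role, with `(R⁻)⁻ = R`. -/
def Role.inverse {NR : Type u} : Role NR → Role NR
  | .name R => .inv R
  | .inv R => .name R

/-! # Saturating the roles of an interpretation -/

namespace Interpretation

variable {NC NR NI : Type u} (I : Interpretation NC NR NI)

theorem mem_roleExt_inverse {S : Role NR} {x y : I.Dom} :
    (x, y) ∈ I.roleExt S.inverse ↔ (y, x) ∈ I.roleExt S := by
  cases S <;> rfl

/-- Every role is enlarged to the product of its domain and its range. -/
def saturate : Interpretation NC NR NI where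
  Dom := I.Dom
  nonempty := I.nonempty
  concept := I.concept
  role R := {p | p.1 ∈ I.basicExt (.ex (.name R)) ∧ p.2 ∈ I.basicExt (.ex (.inv R))}
  ind := I.ind

theorem mem_roleExt_saturate {S : Role NR} {x y : I.Dom} :
    (x, y) ∈ I.saturate.roleExt S ↔
      x ∈ I.basicExt (.ex S) ∧ y ∈ I.basicExt (.ex S.inverse) := by
  cases S with
  | name R => rfl
  | inv R => exact and_comm

theorem basicExt_saturate (B : BasicConcept NC NR) : I.saturate.basicExt B = I.basicExt B := by
  cases B with
  | atom A => rfl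
  | ex S =>
    ext x
    constructor
    · rintro ⟨y, hy⟩
      exact (I.mem_roleExt_saturate.1 hy).1
    · rintro ⟨y, hy⟩
      exact ⟨y, I.mem_roleExt_saturate.2 ⟨⟨y, hy⟩, x, I.mem_roleExt_inverse.2 hy⟩⟩

theorem basicExt_ex_mono {S T : Role NR} (h : I.roleExt S ⊆ I.roleExt T) :
    I.basicExt (.ex S) ⊆ I.basicExt (.ex T) :=
  fun _ ⟨y, hy⟩ => ⟨y, h hy⟩

theorem roleExt_inverse_mono {S T : Role NR} (h : I.roleExt S ⊆ I.roleExt T) :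
    I.roleExt S.inverse ⊆ I.roleExt T.inverse :=
  fun ⟨_, _⟩ hp => I.mem_roleExt_inverse.2 (h (I.mem_roleExt_inverse.1 hp))

theorem roleExt_saturate_mono {S T : Role NR}
    (h : I.basicExt (.ex S) ⊆ I.basicExt (.ex T))
    (h' : I.basicExt (.ex S.inverse) ⊆ I.basicExt (.ex T.inverse)) :
    I.saturate.roleExt S ⊆ I.saturate.roleExt T :=
  fun ⟨_, _⟩ hp =>
    have hp := I.mem_roleExt_saturate.1 hp
    I.mem_roleExt_saturate.2 ⟨h hp.1, h' hp.2⟩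

/-- Role inclusions survive because they pass to domains and ranges, concept axioms because basic
extensions do not change, role assertions because roles only grow. -/
theorem Sat.saturate {α : KBAxiom NC NR NI} (h : I.Sat α) : I.saturate.Sat α := by
  match α, h with
  | .incl (.role S T), h =>
    exact I.roleExt_saturate_mono (I.basicExt_ex_mono h)
      (I.basicExt_ex_mono (I.roleExt_inverse_mono h))
  | .incl (.concept B (.basic C)), h =>
    change I.saturate.basicExt B ⊆ I.saturate.basicExt C
    rw [basicExt_saturate, basicExt_saturate]
    exact h
  | .incl (.concept B (.neg C)), h =>
    change I.saturate.basicExt B ⊆ (I.saturate.basicExt C)ᶜ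
    rw [basicExt_saturate, basicExt_saturate]
    exact h
  | .assertion (.concept D a), h =>
    change I.saturate.ind a ∈ I.saturate.basicExt D
    rw [basicExt_saturate]
    exact h
  | .assertion (.role R a b), h => exact ⟨⟨_, h⟩, _, h⟩

theorem Models.saturate {K : KB NC NR NI} (h : I.Models K) : I.saturate.Models K :=
  fun α hα => Sat.saturate I (h α hα)

end Interpretation

/-! # Entailed subsumption, disjointness and membership -/

namespace KB

variable {NC NR NI : Type u} {K : KB NC NR NI} {B C D E : BasicConcept NC NR} {S T : Role NR}
  {R : NR} {a b : NI}

/-- `K ⊨ B ⊑ C`. -/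
def Subsumed (K : KB NC NR NI) (B C : BasicConcept NC NR) : Prop :=
  K.Entails (.incl (.concept B (.basic C)))

/-- `K ⊨ B ⊑ ¬C`. -/
def Disj (K : KB NC NR NI) (B C : BasicConcept NC NR) : Prop :=
  K.Entails (.incl (.concept B (.neg C)))

/-- `K ⊨ B(a)`. -/
def Inst (K : KB NC NR NI) (a : NI) (B : BasicConcept NC NR) : Prop :=
  K.Entails (.assertion (.concept B a))

theorem Subsumed.refl (B : BasicConcept NC NR) : K.Subsumed B B := fun _ _ _ h => h

theorem Subsumed.trans (h : K.Subsumed B C) (h' : K.Subsumed C D) : K.Subsumed B D :=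
  fun I hI _ hx => h' I hI (h I hI hx)

theorem Disj.symm (h : K.Disj B C) : K.Disj C B := fun I hI _ hx hx' => h I hI hx' hx

theorem Disj.mono (h : K.Disj D E) (hB : K.Subsumed B D) (hC : K.Subsumed C E) : K.Disj B C :=
  fun I hI _ hx hx' => h I hI (hB I hI hx) (hC I hI hx')

theorem Disj.of_self (h : K.Disj B B) (C : BasicConcept NC NR) : K.Disj B C :=
  fun I hI _ hx => absurd hx (h I hI hx)

theorem Subsumed.of_disj_self (h : K.Disj B B) (C : BasicConcept NC NR) : K.Subsumed B C :=
  fun I hI _ hx => absurd hx (h I hI hx)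

theorem Inst.mono (h : K.Inst a B) (h' : K.Subsumed B C) : K.Inst a C :=
  fun I hI => h' I hI (h I hI)

theorem Inst.not_disj (hK : K.Satisfiable) (h : K.Inst a B) (h' : K.Inst a C) : ¬ K.Disj B C :=
  fun hd => let ⟨I, hI⟩ := hK; hd I hI (h I hI) (h' I hI)

theorem Subsumed.ex (h : K.Entails (.incl (.role S T))) : K.Subsumed (.ex S) (.ex T) :=
  fun I hI => I.basicExt_ex_mono (h I hI)

theorem Entails.role_inverse (h : K.Entails (.incl (.role S T))) :
    K.Entails (.incl (.role S.inverse T.inverse)) :=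
  fun I hI => I.roleExt_inverse_mono (h I hI)

theorem Inst.ex_name (h : K.Entails (.assertion (.role R a b))) : K.Inst a (.ex (.name R)) :=
  fun I hI => ⟨_, h I hI⟩

theorem Inst.ex_inv (h : K.Entails (.assertion (.role R a b))) : K.Inst b (.ex (.inv R)) :=
  fun I hI => ⟨_, h I hI⟩

/-- Both sides say that `R` is empty in every model. This makes the bump box, shared by `R` and its
inverse, empty exactly when either head box is. -/
theorem disj_ex_inv : K.Disj (.ex (.inv R)) (.ex (.inv R)) ↔
    K.Disj (.ex (.name R)) (.ex (.name R)) := by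
  constructor <;> rintro h I hI x ⟨y, hy⟩ _ <;> exact h I hI ⟨x, hy⟩ ⟨x, hy⟩

theorem Entails.consistentWith {α : KBAxiom NC NR NI} (hK : K.Satisfiable) (h : K.Entails α) :
    K.ConsistentWith α :=
  let ⟨I, hI⟩ := hK
  ⟨I, hI, h I hI⟩

theorem consistentWith_role_incl (hK : K.Satisfiable) (h : K.Subsumed (.ex S) (.ex T))
    (h' : K.Subsumed (.ex S.inverse) (.ex T.inverse)) :
    K.ConsistentWith (.incl (.role S T)) :=
  let ⟨I, hI⟩ := hK
  ⟨I.saturate, Interpretation.Models.saturate I hI, I.roleExt_saturate_mono (h I hI) (h' I hI)⟩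

theorem consistentWith_role_assertion (hK : K.Satisfiable) (h : K.Inst a (.ex (.name R)))
    (h' : K.Inst b (.ex (.inv R))) : K.ConsistentWith (.assertion (.role R a b)) :=
  let ⟨I, hI⟩ := hK
  ⟨I.saturate, Interpretation.Models.saturate I hI, h I hI, h' I hI⟩

/-! # The coordinates of the construction

There is one coordinate for each basic concept, which separates it from what it does not subsume,
and one for each satisfiable basic concept `C`, which separates `C` from its complement and
realises every pair of non-disjoint concepts containing `C`. -/

/-- Index set of the coordinates. -/
abbrev Coord (K : KB NC NR NI) : Type u :=
  BasicConcept NC NR ⊕ {C : BasicConcept NC NR // ¬ K.Disj C C}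

open Classical in
/-- Left end point of the interval of `B` in a given coordinate. -/
noncomputable def left (K : KB NC NR NI) (B : BasicConcept NC NR) : K.Coord → ℝ
  | .inl C => if K.Subsumed B C then -1 / 2 else -3 / 2
  | .inr C => if K.Subsumed B C then 1 / 2 else -3 / 2

open Classical in
/-- Right end point of the interval of `B` in a given coordinate. -/
noncomputable def right (K : KB NC NR NI) (B : BasicConcept NC NR) : K.Coord → ℝ
  | .inl C => if K.Subsumed B C then 1 / 2 else 3 / 2
  -- The first two cases exclude each other because `C` is satisfiable.
  | .inr C => if K.Subsumed C B then 7 / 2 else if K.Disj B C then -1 / 2 else 3 / 2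

open Classical in
/-- Position of an individual in a given coordinate. -/
noncomputable def point (K : KB NC NR NI) (a : NI) : K.Coord → ℝ
  | .inl C => if K.Inst a C then 0 else 1
  | .inr C => if ∃ F, K.Inst a F ∧ K.Disj F C then -1 else 1

/-! ### Inequalities between end points and positions -/

theorem le_left (c : K.Coord) : -3 / 2 ≤ K.left B c := by
  rcases c with c | c <;> simp only [left] <;> split_ifs <;> norm_num

theorem right_le (c : K.Coord) : K.right B c ≤ 7 / 2 := by
  rcases c with c | c <;> simp only [right] <;> split_ifs <;> norm_num

theorem abs_point_le (c : K.Coord) : |K.point a c| ≤ 1 := by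
  rcases c with c | c <;> simp only [point] <;> split_ifs <;> norm_num

/-- The only bad combination, `1/2` on the left and `-1/2` on the right, would put `B` both below
and disjoint from the same concept. Length `1 ≥ 2ε` keeps the shrunken head boxes non-empty. -/
theorem left_add_one_le (hB : ¬ K.Disj B B) (c : K.Coord) : K.left B c + 1 ≤ K.right B c := by
  rcases c with c | c <;> simp only [left, right]
  · split_ifs <;> norm_num
  · split_ifs with h₁ h₂ h₃ <;> norm_num
    exact hB (h₃.mono (.refl B) h₁)

theorem Subsumed.left_le (h : K.Subsumed B C) (c : K.Coord) : K.left C c ≤ K.left B c := by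
  rcases c with c | c <;> simp only [left] <;> split_ifs with h₁ h₂ <;> norm_num
  all_goals exact h₂ (h.trans h₁)

theorem Subsumed.right_le (h : K.Subsumed B C) (c : K.Coord) : K.right B c ≤ K.right C c := by
  rcases c with c | c <;> simp only [right]
  · split_ifs with h₁ h₂ <;> norm_num
    exact h₁ (h.trans ‹_›)
  · by_cases h₁ : K.Subsumed c B
    · rw [if_pos h₁, if_pos (h₁.trans h)]
    · by_cases h₂ : K.Disj B c
      · rw [if_neg h₁, if_pos h₂]
        split_ifs <;> norm_num
      · rw [if_neg h₁, if_neg h₂, if_neg fun h₃ : K.Disj C c => h₂ (h₃.mono h (.refl _))]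
        split_ifs <;> norm_num

theorem left_lt_of_not_subsumed (h : ¬ K.Subsumed B C) :
    K.left B (.inl C) < K.left C (.inl C) := by
  simp only [left, if_neg h, if_pos (Subsumed.refl (K := K) C)]
  norm_num

/-- If one concept lies above `c`, the other is disjoint from `c`, and `7/2 - 1/2 = 3`; otherwise
both ends are at most `3/2`. -/
theorem right_add_right_le (h : K.Disj B C) (c : K.Coord) : K.right B c + K.right C c ≤ 3 := by
  rcases c with c | c <;> simp only [right]
  · split_ifs <;> norm_num
  · by_cases h₁ : K.Subsumed c B
    · have h₂ : K.Disj C c := h.symm.mono (.refl C) h₁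
      have h₃ : ¬ K.Subsumed c C := fun h₃ => c.2 (h₂.mono h₃ (.refl _))
      rw [if_pos h₁, if_neg h₃, if_pos h₂]
      norm_num
    · by_cases h₂ : K.Subsumed c C
      · rw [if_neg h₁, if_pos (h.mono (.refl B) h₂), if_pos h₂]
        norm_num
      · rw [if_neg h₁, if_neg h₂]
        split_ifs <;> norm_num

theorem right_of_self (hB : ¬ K.Disj B B) : K.right B (.inr ⟨B, hB⟩) = 7 / 2 :=
  if_pos (Subsumed.refl B)

theorem left_of_self (hB : ¬ K.Disj B B) : K.left B (.inr ⟨B, hB⟩) = 1 / 2 :=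
  if_pos (Subsumed.refl B)

theorem le_right_of_not_disj (hB : ¬ K.Disj B B) (h : ¬ K.Disj B C) :
    3 / 2 ≤ K.right C (.inr ⟨B, hB⟩) := by
  simp only [right, if_neg fun h' : K.Disj C B => h h'.symm]
  split_ifs <;> norm_num

/-- The slack `1/2 ≥ ε` puts positions inside the smaller head boxes as well. -/
theorem Inst.left_le_point (hK : K.Satisfiable) (h : K.Inst a B) (c : K.Coord) :
    K.left B c + 1 / 2 ≤ K.point a c := by
  rcases c with c | c <;> simp only [left, point] <;> split_ifs with h₁ h₂ <;> norm_num
  obtain ⟨F, hF, hFc⟩ := h₂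
  exact hF.not_disj hK (h.mono h₁) hFc

theorem Inst.point_le_right (h : K.Inst a B) (c : K.Coord) :
    K.point a c ≤ K.right B c - 1 / 2 := by
  rcases c with c | c <;> simp only [right, point]
  · by_cases h₁ : K.Subsumed B c
    · rw [if_pos (h.mono h₁), if_pos h₁]
      norm_num
    · rw [if_neg h₁]
      split_ifs <;> norm_num
  · by_cases h₁ : K.Disj B c
    · rw [if_pos ⟨B, h, h₁⟩]
      split_ifs <;> norm_num
    · rw [if_neg h₁]
      split_ifs <;> norm_num

theorem right_lt_point_of_not_inst (h : ¬ K.Inst a B) :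
    K.right B (.inl B) < K.point a (.inl B) := by
  simp only [right, point, if_neg h, if_pos (Subsumed.refl (K := K) B)]
  norm_num

end KB

/-! # Boxes -/

section Boxes

variable {d : ℕ} {ε s : ℝ} {L U L' U' : Fin d → ℝ}

theorem boxSet_nonempty (h : ∀ i, L i + ε ≤ U i - ε) : (boxSet ε L U).Nonempty :=
  ⟨fun i => L i + ε, fun i => ⟨le_rfl, h i⟩⟩

theorem boxSet_subset (hL : ∀ i, L' i ≤ L i) (hU : ∀ i, U i ≤ U' i) :
    boxSet ε L U ⊆ boxSet ε L' U' :=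
  fun _ hx i => ⟨by linarith [(hx i).1, hL i], by linarith [(hx i).2, hU i]⟩

theorem boxSet_subset_iff (h : ∀ i, L i + ε ≤ U i - ε) :
    boxSet ε L U ⊆ boxSet ε L' U' ↔ ∀ i, L' i ≤ L i ∧ U i ≤ U' i := by
  refine ⟨fun hs i => ?_, fun h' => boxSet_subset (fun i => (h' i).1) fun i => (h' i).2⟩
  have h₁ := (hs (a := fun i => L i + ε) fun i => ⟨le_rfl, h i⟩) i
  have h₂ := (hs (a := fun i => U i - ε) fun i => ⟨h i, le_rfl⟩) i
  exact ⟨by linarith [h₁.1], by linarith [h₂.2]⟩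

theorem boxSet_zero_zero (hε : 0 < ε) (hd : 0 < d) : boxSet (d := d) ε 0 0 = ∅ := by
  refine Set.eq_empty_of_forall_notMem fun x hx => ?_
  have h := hx ⟨0, hd⟩
  simp only [Pi.zero_apply] at h
  linarith [h.1, h.2]

theorem isBox_empty (hε : 0 < ε) (hs : 0 ≤ s) (hd : 0 < d) :
    IsBox ε s (∅ : Set (Fin d → ℝ)) :=
  ⟨0, 0, fun i => by simp [hs], (boxSet_zero_zero hε hd).symm⟩

theorem lower_empty : lower ε (∅ : Set (Fin d → ℝ)) = 0 := by simp [lower]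

theorem upper_empty : upper ε (∅ : Set (Fin d → ℝ)) = 0 := by simp [upper]

theorem complBox_empty :
    complBox ε s (∅ : Set (Fin d → ℝ)) = boxSet ε (fun _ => -s) (fun _ => s) := by
  simp [complBox, lower_empty, upper_empty]

theorem complBox_boxSet (h : ∀ i, L i + ε ≤ U i - ε) :
    complBox ε s (boxSet ε L U) = boxSet ε (fun i => -s - L i) (fun i => s - U i) := by
  have h := boxSet_nonempty h
  rw [complBox, lower_boxSet h, upper_boxSet h]

end Boxes

/-! # The box interpretation of a knowledge base -/

namespace KB

variable {NC NR NI : Type u} {K : KB NC NR NI} {d : ℕ} {e : Fin d → K.Coord} {ε : ℝ}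
  {B C : BasicConcept NC NR} {S T : Role NR} {a : NI}

open Classical in
/-- The box of a basic concept: the product of the intervals from `left` to `right`, or empty if
the concept is unsatisfiable. -/
noncomputable def conceptBox (K : KB NC NR NI) (e : Fin d → K.Coord) (ε : ℝ)
    (B : BasicConcept NC NR) : Set (Fin d → ℝ) :=
  if K.Disj B B then ∅
  else boxSet ε (fun i => K.left B (e i) - ε) (fun i => K.right B (e i) + ε)

open Classical in
/-- The head box of a role, which is the box of `∃ S` shrunk by the margin. -/
noncomputable def headBox (K : KB NC NR NI) (e : Fin d → K.Coord) (ε : ℝ) (S : Role NR) :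
    Set (Fin d → ℝ) :=
  if K.Disj (.ex S) (.ex S) then ∅
  else boxSet ε (fun i => K.left (.ex S) (e i)) (fun i => K.right (.ex S) (e i))

open Classical in
/-- The bump box of a role: the origin, or empty if the role is unsatisfiable. -/
noncomputable def originBox (K : KB NC NR NI) (d : ℕ) (ε : ℝ) (R : NR) : Set (Fin d → ℝ) :=
  if K.Disj (.ex (.name R)) (.ex (.name R)) then ∅ else boxSet ε (fun _ => -ε) (fun _ => ε)

theorem isBox_conceptBox (hε : 0 < ε) (hε' : ε ≤ 1 / 2) (hd : 0 < d) :
    IsBox ε 4 (K.conceptBox e ε B) := by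
  unfold conceptBox
  split_ifs with h
  · exact isBox_empty hε (by norm_num) hd
  · refine ⟨_, _, fun i => ⟨?_, ?_⟩, rfl⟩
    · linarith [left_add_one_le h (e i)]
    · linarith [le_left (B := B) (e i), right_le (B := B) (e i)]

theorem isBox_headBox (hε : 0 < ε) (hd : 0 < d) : IsBox ε 4 (K.headBox e ε S) := by
  unfold headBox
  split_ifs with h
  · exact isBox_empty hε (by norm_num) hd
  · refine ⟨_, _, fun i => ⟨?_, ?_⟩, rfl⟩
    · linarith [left_add_one_le h (e i)]
    · linarith [le_left (B := .ex S) (e i), right_le (B := .ex S) (e i)]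

theorem isBox_originBox (hε : 0 < ε) (hε' : ε ≤ 1 / 2) (hd : 0 < d) (R : NR) :
    IsBox ε 4 (K.originBox d ε R) := by
  unfold originBox
  split_ifs with h
  · exact isBox_empty hε (by norm_num) hd
  · exact ⟨_, _, fun i => ⟨by linarith, by linarith⟩, rfl⟩

/-- The box interpretation of a knowledge base, with coordinates enumerated by `e`. -/
noncomputable def boxInterpretation (K : KB NC NR NI) (e : Fin d → K.Coord) (hε : 0 < ε)
    (hε' : ε ≤ 1 / 2) (hd : 0 < d) : BoxInterpretation ε 4 d NC NR NI where
  pos a i := K.point a (e i)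
  bump _ := 0
  concept A := K.conceptBox e ε (.atom A)
  head R := K.headBox e ε (.name R)
  tail R := K.headBox e ε (.inv R)
  bumpBox R := K.originBox d ε R
  pos_mem a i := by
    have h := abs_le.1 (abs_point_le (a := a) (e i))
    exact ⟨by linarith [h.1], by linarith [h.2]⟩
  bump_mem _ i := by simp
  concept_isBox _ := isBox_conceptBox hε hε' hd
  head_isBox _ := isBox_headBox hε hd
  tail_isBox _ := isBox_headBox hε hd
  bumpBox_isBox := isBox_originBox hε hε' hd

variable (hε : 0 < ε) (hε' : ε ≤ 1 / 2) (hd : 0 < d)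

theorem roleHead_boxInterpretation (S : Role NR) :
    (K.boxInterpretation e hε hε' hd).roleHead S = K.headBox e ε S := by
  cases S <;> rfl

theorem roleTail_boxInterpretation (S : Role NR) :
    (K.boxInterpretation e hε hε' hd).roleTail S = K.headBox e ε S.inverse := by
  cases S <;> rfl

theorem roleBump_boxInterpretation_of_disj (h : K.Disj (.ex S) (.ex S)) :
    (K.boxInterpretation e hε hε' hd).roleBump S = ∅ := by
  cases S with
  | name R => exact if_pos h
  | inv R => exact if_pos (disj_ex_inv.1 h)

theorem roleBump_boxInterpretation_of_not_disj (h : ¬ K.Disj (.ex S) (.ex S)) :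
    (K.boxInterpretation e hε hε' hd).roleBump S = boxSet ε (fun _ => -ε) (fun _ => ε) := by
  cases S with
  | name R => exact if_neg h
  | inv R => exact if_neg fun h' => h (disj_ex_inv.2 h')

/-- The bump box `{0}` has bounds `-ε` and `ε`, so forming `∃ S` undoes exactly the shrinking of the
head box. -/
theorem basicBox_boxInterpretation (B : BasicConcept NC NR) :
    (K.boxInterpretation e hε hε' hd).basicBox B = K.conceptBox e ε B := by
  cases B with
  | atom A => rfl
  | ex S =>
    rw [BoxInterpretation.basicBox, roleHead_boxInterpretation]
    by_cases h : K.Disj (.ex S) (.ex S)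
    -- Empty boxes have both bounds `0`, and the box with bounds `0`, `0` is again empty since `ε`
    -- and `d` are positive.
    · rw [roleBump_boxInterpretation_of_disj hε hε' hd h, headBox, conceptBox, if_pos h, if_pos h,
        lower_empty, upper_empty, ← boxSet_zero_zero hε hd]
      congr 1 <;> ext <;> simp
    · have h₁ : (boxSet ε (fun i => K.left (.ex S) (e i))
          (fun i => K.right (.ex S) (e i))).Nonempty :=
        boxSet_nonempty fun i => by linarith [left_add_one_le h (e i)]
      have h₂ : (boxSet ε (fun _ : Fin d => -ε) (fun _ => ε)).Nonempty :=
        boxSet_nonempty fun i => by linarith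
      rw [roleBump_boxInterpretation_of_not_disj hε hε' hd h, headBox, conceptBox, if_neg h,
        if_neg h, lower_boxSet h₁, upper_boxSet h₁, lower_boxSet h₂, upper_boxSet h₂]
      simp only [sub_neg_eq_add]

theorem conceptBox_of_disj (h : K.Disj B B) : K.conceptBox e ε B = ∅ := if_pos h

theorem mem_conceptBox (h : ¬ K.Disj B B) {x : Fin d → ℝ} :
    x ∈ K.conceptBox e ε B ↔ ∀ i, K.left B (e i) ≤ x i ∧ x i ≤ K.right B (e i) := by
  simp [conceptBox, if_neg h, boxSet]

theorem conceptBox_nonempty (h : ¬ K.Disj B B) : (K.conceptBox e ε B).Nonempty :=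
  ⟨fun i => K.left B (e i), (mem_conceptBox h).2 fun i =>
    ⟨le_rfl, by linarith [left_add_one_le h (e i)]⟩⟩

theorem conceptBox_subset_boxSet_iff (h : ¬ K.Disj B B) {L U : Fin d → ℝ} :
    K.conceptBox e ε B ⊆ boxSet ε L U ↔
      ∀ i, L i ≤ K.left B (e i) - ε ∧ K.right B (e i) + ε ≤ U i := by
  rw [conceptBox, if_neg h, boxSet_subset_iff fun i => by linarith [left_add_one_le h (e i)]]

/-! ### Concept boxes mirror entailment -/

theorem conceptBox_subset_conceptBox_iff (he : Function.Surjective e) :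
    K.conceptBox e ε B ⊆ K.conceptBox e ε C ↔ K.Subsumed B C := by
  by_cases hB : K.Disj B B
  · simp [conceptBox_of_disj hB, Subsumed.of_disj_self hB]
  constructor
  · intro h
    have hC : ¬ K.Disj C C := fun hC => by
      rw [conceptBox_of_disj hC] at h
      exact (conceptBox_nonempty hB).ne_empty (Set.subset_empty_iff.1 h)
    rw [conceptBox.eq_1 K e ε C, if_neg hC, conceptBox_subset_boxSet_iff hB] at h
    by_contra hBC
    obtain ⟨i, hi⟩ := he (.inl C)
    have := (h i).1
    rw [hi] at this
    linarith [left_lt_of_not_subsumed hBC]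
  · intro h
    have hC : ¬ K.Disj C C := fun hC => hB (hC.mono h h)
    rw [conceptBox.eq_1 K e ε C, if_neg hC, conceptBox_subset_boxSet_iff hB]
    exact fun i => ⟨by linarith [h.left_le (e i)], by linarith [h.right_le (e i)]⟩

include hε hε' in
theorem conceptBox_subset_complBox_iff (he : Function.Surjective e) :
    K.conceptBox e ε B ⊆ complBox ε 4 (K.conceptBox e ε C) ↔ K.Disj B C := by
  by_cases hB : K.Disj B B
  · simp [conceptBox_of_disj hB, hB.of_self]
  by_cases hC : K.Disj C C
  · refine iff_of_true ?_ (hC.of_self B).symm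
    rw [conceptBox_of_disj hC, complBox_empty, conceptBox_subset_boxSet_iff hB]
    exact fun i => ⟨by linarith [le_left (B := B) (e i)], by linarith [right_le (B := B) (e i)]⟩
  rw [conceptBox.eq_1 K e ε C, if_neg hC,
    complBox_boxSet fun i => by linarith [left_add_one_le hC (e i)],
    conceptBox_subset_boxSet_iff hB]
  constructor
  · intro h
    by_contra hBC
    -- Here the right ends sum to at least `5`, above the permitted `4 - 2ε`.
    obtain ⟨i, hi⟩ := he (.inr ⟨B, hB⟩)
    have := (h i).2
    rw [hi] at this
    linarith [right_of_self hB, le_right_of_not_disj hB hBC]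
  -- The left ends sum to at least `-3` and the right ends to at most `3`; the bounds needed are
  -- `∓(4 - 2ε)`, which is where `ε ≤ 1/2` enters.
  · exact fun h i => ⟨by linarith [le_left (B := B) (e i), le_left (B := C) (e i)],
      by linarith [right_add_right_le h (e i)]⟩

include hε in
theorem conceptBox_inter_complBox (he : Function.Surjective e) :
    K.conceptBox e ε B ∩ complBox ε 4 (K.conceptBox e ε B) = ∅ := by
  by_cases hB : K.Disj B B
  · rw [conceptBox_of_disj hB, Set.empty_inter]
  refine Set.eq_empty_of_forall_notMem fun x hx => ?_
  have hx₁ := (mem_conceptBox hB).1 hx.1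
  have hx₂ := hx.2
  rw [conceptBox, if_neg hB, complBox_boxSet fun i => by linarith [left_add_one_le hB (e i)]]
    at hx₂
  -- In its own coordinate `B` starts at `1/2`, while its complement stops at `4 - 7/2 - 2ε = 1/2 -
  -- 2ε`.
  obtain ⟨i, hi⟩ := he (.inr ⟨B, hB⟩)
  have h₁ := (hx₁ i).1
  have h₂ := (hx₂ i).2
  simp only [hi] at h₁ h₂
  linarith [left_of_self hB, right_of_self hB]

theorem point_mem_conceptBox_iff (hK : K.Satisfiable) (he : Function.Surjective e) :
    (fun i => K.point a (e i)) ∈ K.conceptBox e ε B ↔ K.Inst a B := by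
  by_cases hB : K.Disj B B
  · rw [conceptBox_of_disj hB]
    exact iff_of_false (Set.notMem_empty _) fun h => h.not_disj hK h hB
  rw [mem_conceptBox hB]
  constructor
  · intro h
    by_contra ha
    obtain ⟨i, hi⟩ := he (.inl B)
    have := (h i).2
    rw [hi] at this
    linarith [right_lt_point_of_not_inst ha]
  · exact fun h i => ⟨by linarith [h.left_le_point hK (e i)], by linarith [h.point_le_right (e i)]⟩

/-! ### Head boxes and role axioms -/

include hε in
theorem headBox_subset_conceptBox : K.headBox e ε S ⊆ K.conceptBox e ε (.ex S) := by
  unfold headBox conceptBox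
  split_ifs
  · exact subset_rfl
  · exact boxSet_subset (fun i => by linarith) fun i => by linarith

theorem headBox_mono (h : K.Subsumed (.ex S) (.ex T)) : K.headBox e ε S ⊆ K.headBox e ε T := by
  by_cases hS : K.Disj (.ex S) (.ex S)
  · rw [headBox, if_pos hS]
    exact Set.empty_subset _
  · rw [headBox, if_neg hS, headBox, if_neg fun hT : K.Disj (.ex T) (.ex T) => hS (hT.mono h h)]
    exact boxSet_subset (fun i => h.left_le (e i)) fun i => h.right_le (e i)

include hε' in
theorem Subsumed.of_headBox_subset (he : Function.Surjective e)
    (h : K.headBox e ε S ⊆ K.headBox e ε T) : K.Subsumed (.ex S) (.ex T) := by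
  by_cases hS : K.Disj (.ex S) (.ex S)
  · exact .of_disj_self hS _
  have hS' : ∀ i, K.left (.ex S) (e i) + ε ≤ K.right (.ex S) (e i) - ε :=
    fun i => by linarith [left_add_one_le hS (e i)]
  rw [headBox, if_neg hS] at h
  have hT : ¬ K.Disj (.ex T) (.ex T) := fun hT => by
    rw [headBox, if_pos hT] at h
    exact (boxSet_nonempty hS').ne_empty (Set.subset_empty_iff.1 h)
  rw [headBox, if_neg hT, boxSet_subset_iff hS'] at h
  by_contra hST
  obtain ⟨i, hi⟩ := he (.inl (.ex T))
  have := (h i).1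
  rw [hi] at this
  linarith [left_lt_of_not_subsumed hST]

include hε' in
theorem Inst.point_mem_headBox (hK : K.Satisfiable) (h : K.Inst a (.ex S)) :
    (fun i => K.point a (e i)) ∈ K.headBox e ε S := by
  rw [headBox, if_neg (h.not_disj hK h)]
  exact fun i => ⟨by linarith [h.left_le_point hK (e i)], by linarith [h.point_le_right (e i)]⟩

theorem boxInterpretation_sat_concept_incl_iff (he : Function.Surjective e)
    (B : BasicConcept NC NR) (C : Concept NC NR) :
    (K.boxInterpretation e hε hε' hd).Sat (.incl (.concept B C)) ↔
      K.Entails (.incl (.concept B C)) := by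
  cases C with
  | basic C =>
    simp only [BoxInterpretation.Sat, BoxInterpretation.conceptBox, basicBox_boxInterpretation]
    exact conceptBox_subset_conceptBox_iff he
  | neg C =>
    simp only [BoxInterpretation.Sat, BoxInterpretation.conceptBox, basicBox_boxInterpretation]
    exact conceptBox_subset_complBox_iff hε hε' he

theorem boxInterpretation_sat_concept_assertion_iff (hK : K.Satisfiable)
    (he : Function.Surjective e) (D : BasicConcept NC NR) (a : NI) :
    (K.boxInterpretation e hε hε' hd).Sat (.assertion (.concept D a)) ↔
      K.Entails (.assertion (.concept D a)) := by
  simp only [BoxInterpretation.Sat, basicBox_boxInterpretation]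
  exact point_mem_conceptBox_iff hK he

theorem boxInterpretation_sat_role_incl (h : K.Entails (.incl (.role S T))) :
    (K.boxInterpretation e hε hε' hd).Sat (.incl (.role S T)) := by
  simp only [BoxInterpretation.Sat, roleHead_boxInterpretation, roleTail_boxInterpretation]
  refine ⟨?_, headBox_mono (.ex h), headBox_mono (.ex h.role_inverse)⟩
  by_cases hS : K.Disj (.ex S) (.ex S)
  · rw [roleBump_boxInterpretation_of_disj hε hε' hd hS]
    exact Set.empty_subset _
  · rw [roleBump_boxInterpretation_of_not_disj hε hε' hd hS,
      roleBump_boxInterpretation_of_not_disj hε hε' hd fun hT => hS (hT.mono (.ex h) (.ex h))]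

theorem boxInterpretation_sat_role_assertion (hK : K.Satisfiable) {R : NR} {a b : NI}
    (h : K.Entails (.assertion (.role R a b))) :
    (K.boxInterpretation e hε hε' hd).Sat (.assertion (.role R a b)) := by
  have ha := Inst.ex_name h
  have h₀ : (0 : Fin d → ℝ) ∈ K.originBox d ε R := by
    rw [originBox, if_neg (ha.not_disj hK ha)]
    exact fun i => ⟨by simp, by simp⟩
  simp only [BoxInterpretation.Sat, boxInterpretation, add_zero]
  exact ⟨ha.point_mem_headBox hε' hK, (Inst.ex_inv h).point_mem_headBox hε' hK, h₀, h₀⟩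

theorem boxInterpretation_boxConsistent (he : Function.Surjective e) :
    (K.boxInterpretation e hε hε' hd).BoxConsistent := by
  intro B
  rw [basicBox_boxInterpretation]
  exact conceptBox_inter_complBox hε he

theorem boxInterpretation_kbEntailed (hK : K.Satisfiable) (he : Function.Surjective e) :
    (K.boxInterpretation e hε hε' hd).KBEntailed K := by
  intro α h
  match α, h with
  | .incl (.role S T), h => exact boxInterpretation_sat_role_incl hε hε' hd h
  | .incl (.concept B C), h =>
    exact (boxInterpretation_sat_concept_incl_iff hε hε' hd he B C).2 h
  | .assertion (.concept D a), h =>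
    exact (boxInterpretation_sat_concept_assertion_iff hε hε' hd hK he D a).2 h
  | .assertion (.role R a b), h => exact boxInterpretation_sat_role_assertion hε hε' hd hK h

theorem boxInterpretation_weaklyFaithful (hK : K.Satisfiable) (he : Function.Surjective e) :
    (K.boxInterpretation e hε hε' hd).WeaklyFaithful K := by
  intro α h
  match α, h with
  | .incl (.role S T), h =>
    simp only [BoxInterpretation.Sat, roleHead_boxInterpretation, roleTail_boxInterpretation] at h
    exact consistentWith_role_incl hK (.of_headBox_subset hε' he h.2.1)
      (.of_headBox_subset hε' he h.2.2)
  | .incl (.concept B C), h =>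
    exact ((boxInterpretation_sat_concept_incl_iff hε hε' hd he B C).1 h).consistentWith hK
  | .assertion (.concept D a), h =>
    exact ((boxInterpretation_sat_concept_assertion_iff hε hε' hd hK he D a).1 h).consistentWith hK
  | .assertion (.role R a b), h =>
    -- With zero bumps, only membership of the two positions in the head and tail boxes matters.
    simp only [BoxInterpretation.Sat, boxInterpretation, add_zero] at h
    exact consistentWith_role_assertion hK
      ((point_mem_conceptBox_iff hK he).1 (headBox_subset_conceptBox hε h.1))
      ((point_mem_conceptBox_iff hK he).1 (headBox_subset_conceptBox hε h.2.1))

end KB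

end BoxLitE

theorem theorem2 :
    ∃ s : ℝ, s = 4 ∧ ∀ ε : ℝ, 0 < ε → ε ≤ 1 / 2 →
      ∀ (NC NR NI : Type u) [Finite NC] [Finite NR] [Finite NI]
        [Nonempty NC] [Nonempty NR] [Nonempty NI] (K : BoxLitE.KB NC NR NI),
        K.Satisfiable →
          ∃ d : ℕ, 0 < d ∧ ∃ η : BoxLitE.BoxInterpretation ε s d NC NR NI,
            η.BoxConsistent ∧ η.KBFaithfulModel K ∧
            (∀ (B : BoxLitE.BasicConcept NC NR) (C : BoxLitE.Concept NC NR),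
              K.Entails (.incl (.concept B C)) ↔ η.Sat (.incl (.concept B C))) ∧
            (∀ (D : BoxLitE.BasicConcept NC NR) (a : NI),
              K.Entails (.assertion (.concept D a)) ↔ η.Sat (.assertion (.concept D a))) := by
  refine ⟨4, rfl, fun ε hε hε' NC NR NI _ _ _ _ _ _ K hK => ?_⟩
  have := BoxLitE.finite_basicConcept (NC := NC) (NR := NR)
  -- A concept name guarantees positive dimension; in dimension `0` no box would be empty.
  have : Nonempty K.Coord := ⟨.inl (.atom (Classical.arbitrary NC))⟩
  have hd : 0 < Nat.card K.Coord := Nat.card_pos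
  have he := (Finite.equivFin K.Coord).symm.surjective
  exact ⟨_, hd, K.boxInterpretation _ hε hε' hd,
    BoxLitE.KB.boxInterpretation_boxConsistent hε hε' hd he,
    ⟨BoxLitE.KB.boxInterpretation_weaklyFaithful hε hε' hd hK he,
      BoxLitE.KB.boxInterpretation_kbEntailed hε hε' hd hK he⟩,
    fun B C => (BoxLitE.KB.boxInterpretation_sat_concept_incl_iff hε hε' hd he B C).symm,
    fun D a =>
      (BoxLitE.KB.boxInterpretation_sat_concept_assertion_iff hε hε' hd hK he D a).symm⟩
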